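/- Let $\Bbbk$ be an algebraically closed field of characteristic $0$, let $\mathcal S=\Bbbk[X_0,\dots,X_n]$, and let $\mathcal R=\Bbbk[Y_0,\dots,Y_n]$ be its dual ring, acting on $\mathcal S$ by differentiation ($Y_i\circ F=\partial F/\partial X_i$) and identified with the coordinate ring of $\mathbb P^n=\mathbb P(\mathcal S_1)$. For a nonzero linear form $L\in\mathcal S_1$ let $\wp_L\subset\mathcal R$ be the homogeneous ideal of the point $[L]\in\mathbb P^n$. A $0$-dimensional scheme $Z\subset\mathbb P^n$ with saturated homogeneous ideal $I(Z)\subseteq\mathcal R$ is apolar to $F\in\mathcal S_d$ if $G\circ F=0$ for all $G\in I(Z)$. For $F\in\mathcal S_d$ and $0\ne L\in\mathcal S_1$, complete $L$ to a basis $L=L_0',L_1',\dots,L_n'$ of $\mathcal S_1$ and write $F=\sum_{|\alpha|=d}c_\alpha\prod_{m=0}^n (L_m')^{\alpha_m}/\alpha_m!$. Put $f_L=\sum_\alpha c_\alpha\, x_1^{[\alpha_1]}\cdots x_n^{[\alpha_n]}$ in divided powers. The natural apolar scheme $Z_{F,L}$ is the closed subscheme of $\mathbb P^n$ supported at $[L]$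 (empty if $F=0$) which, in the affine chart $(y_1,\dots,y_n)\mapsto[L+y_1L_1'+\dots+y_nL_n']$, is defined by the ideal of all $g\in\Bbbk[y_1,\dots,y_n]$ that annihilate $f_L$ under contraction ($y^\beta$ sends $x^{[\alpha]}$ to $x^{[\alpha-\beta]}$ if $\beta\le\alpha$ componentwise, and to $0$ otherwise). It does not depend on the choice of the basis. A generalized additive decomposition (GAD) of $F\in\mathcal S_d$ supported at a finite family of pairwise non-proportional nonzero linear forms $(L_i)_{i\in J}$ is an expression $F=\sum_{i\in J}L_i^{d-k_i}G_i$ with $0\le k_i\le d$ and $G_i\in\mathcal S_{k_i}$ not divisible by $L_i$ (for $F=0$ the empty decomposition is allowed). The scheme evinced by it is $\bigcup_{i\in J}Z_{L_i^{d-k_i}G_i,\,L_i}$. **Corollary.** Let $F\in\mathcal S_d$, let $L_1,\dots,L_s\in\mathcal S_1$ be nonzero linear forms, and let $Z=Z_1\cup\dots\cup Z_s\subset\mathbb P^n$ be a $0$-dimensional scheme apolar to $F$ such that for every $i\in\{1,\dots,s\}$ we have $I(Z_i)\supseteq\wp_{L_i}^{\tilde k_i+1}$ for some integer $0\le\tilde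 k_i\le d$. Then there is a subset $J\subseteq\{1,\dots,s\}$ and a GAD $$F=\sum_{i\in J}L_i^{d-k_i}G_i$$ supported at $(L_i)_{i\in J}$, with $k_i\le\tilde k_i$ for every $i\in J$, such that $Z$ contains the scheme evinced by this GAD. -/

import Mathlib

noncomputable section

namespace GADScheme

/-! Both `S = 𝕜[X_0,…,X_n]` and its dual ring `R = 𝕜[Y_0,…,Y_n]` are modelled by
`MvPolynomial (Fin (n + 1)) 𝕜`. A linear form `L = ℓ_0 X_0 + … + ℓ_n X_n` is given by its
coefficient vector `ℓ`, which is also the coordinate vector of the point `[L]` of `ℙⁿ = ℙ(S_1)`,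
whose coordinate ring is `R`. -/

/-- The apolarity action of `R` on `S` by differentiation: the bilinear extension of
`Y^β ∘ X^α = α! / (α - β)! X^(α - β)` if `β ≤ α`, and `0` otherwise. -/
def diffAct {𝕜 : Type*} [Field 𝕜] {σ : Type*} [Fintype σ] (G F : MvPolynomial σ 𝕜) :
    MvPolynomial σ 𝕜 :=
  open Classical in
  ∑ β ∈ G.support, ∑ α ∈ F.support,
    if β ≤ α then
      MvPolynomial.monomial (α - β)
        (G.coeff β * F.coeff α * ∏ i, ((α i).descFactorial (β i) : 𝕜))
    else 0

/-! ### Closed subschemes of projective space -/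

/-- A closed subscheme `Z` of `ℙⁿ`, given by its saturated homogeneous ideal `I(Z) ⊆ R`. -/
@[ext] structure ProjSubscheme (𝕜 : Type*) [Field 𝕜] (n : ℕ) where
  /-- the ideal `I(Z)` -/
  ideal : Ideal (MvPolynomial (Fin (n + 1)) 𝕜)
  homogeneous : ∀ G ∈ ideal, ∀ e, MvPolynomial.homogeneousComponent e G ∈ ideal
  saturated : ∀ G, (∀ i, MvPolynomial.X i * G ∈ ideal) → G ∈ ideal

/-- `Z` contains `W` as a closed subscheme. -/
def ProjSubscheme.Contains {𝕜 : Type*} [Field 𝕜] {n : ℕ} (Z W : ProjSubscheme 𝕜 n) : Prop :=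
  Z.ideal ≤ W.ideal

/-- `Z` has dimension at most zero (the empty scheme is allowed): the affine cone over `Z` has
dimension at most one. -/
def ProjSubscheme.IsZeroDim {𝕜 : Type*} [Field 𝕜] {n : ℕ} (Z : ProjSubscheme 𝕜 n) : Prop :=
  ringKrullDim (MvPolynomial (Fin (n + 1)) 𝕜 ⧸ Z.ideal) ≤ 1

/-- The scheme-theoretic union, defined by the intersection of the ideals. The union of the empty
family is the empty scheme. -/
def ProjSubscheme.union {𝕜 : Type*} [Field 𝕜] {n : ℕ} {ι : Type*}
    (Z : ι → ProjSubscheme 𝕜 n) : ProjSubscheme 𝕜 n where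
  ideal := ⨅ i, (Z i).ideal
  homogeneous G hG e := by
    rw [Ideal.mem_iInf] at hG ⊢
    exact fun i => (Z i).homogeneous G (hG i) e
  saturated G hG := by
    simp only [Ideal.mem_iInf] at hG ⊢
    exact fun i => (Z i).saturated G fun j => hG j i

/-- `Z` is apolar to `F`: `I(Z) ⊆ Ann(F)`. -/
def ProjSubscheme.IsApolar {𝕜 : Type*} [Field 𝕜] {n : ℕ} (Z : ProjSubscheme 𝕜 n)
    (F : MvPolynomial (Fin (n + 1)) 𝕜) : Prop :=
  ∀ G ∈ Z.ideal, diffAct G F = 0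

/-- The homogeneous ideal generated by the forms that belong to `K`. -/
def formsIdeal {𝕜 : Type*} [Field 𝕜] {n : ℕ} (K : Ideal (MvPolynomial (Fin (n + 1)) 𝕜)) :
    Ideal (MvPolynomial (Fin (n + 1)) 𝕜) :=
  Ideal.span {G | G ∈ K ∧ ∃ e, G.IsHomogeneous e}

theorem formsIdeal_le {𝕜 : Type*} [Field 𝕜] {n : ℕ}
    (K : Ideal (MvPolynomial (Fin (n + 1)) 𝕜)) : formsIdeal K ≤ K :=
  Ideal.span_le.2 fun _ h => h.1

theorem formsIdeal_homogeneous {𝕜 : Type*} [Field 𝕜] {n : ℕ}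
    (K : Ideal (MvPolynomial (Fin (n + 1)) 𝕜))
    (G : MvPolynomial (Fin (n + 1)) 𝕜) (hG : G ∈ formsIdeal K) (e : ℕ) :
    MvPolynomial.homogeneousComponent e G ∈ formsIdeal K := by
  let _ := MvPolynomial.gradedAlgebra (σ := Fin (n + 1)) (R := 𝕜)
  have h : (formsIdeal K).IsHomogeneous (MvPolynomial.homogeneousSubmodule (Fin (n + 1)) 𝕜) :=
    Ideal.homogeneous_span _ _ fun x hx => hx.2
  exact (MvPolynomial.mem_iff_homogeneousComponent_mem h G).1 hG e

/-- The homogeneous ideal `℘_L` of the simple point `[L]`: it is generated by the forms that vanish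
at the point with coordinate vector `ℓ`. -/
def pointIdeal {𝕜 : Type*} [Field 𝕜] {n : ℕ} (ℓ : Fin (n + 1) → 𝕜) :
    Ideal (MvPolynomial (Fin (n + 1)) 𝕜) :=
  formsIdeal (RingHom.ker (MvPolynomial.eval ℓ))

/-! ### Divided powers and contraction

An element of a divided power ring is written as an `MvPolynomial` whose coefficient at `α` is the
coefficient of the divided power monomial `X^[α] = X^α / α!`. -/

/-- `F ↦ F_dp`, the expression of a polynomial in the divided power basis. -/
def toDP {𝕜 : Type*} [Field 𝕜] {σ : Type*} [Fintype σ] (F : MvPolynomial σ 𝕜) :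
    MvPolynomial σ 𝕜 :=
  ∑ α ∈ F.support, MvPolynomial.monomial α (F.coeff α * ∏ i, ((α i).factorial : 𝕜))

/-- The contraction action: the bilinear extension of `Y^β ⌟ X^[α] = X^[α - β]` if `β ≤ α`, and
`0` otherwise. Here `f.divMonomial β` is Mathlib's name for `Y^β ⌟ f`. -/
def contract {𝕜 : Type*} [Field 𝕜] {σ : Type*} (G f : MvPolynomial σ 𝕜) : MvPolynomial σ 𝕜 :=
  ∑ β ∈ G.support, G.coeff β • f.divMonomial β

theorem contract_eq_sum {𝕜 : Type*} [Field 𝕜] {σ : Type*} (G f : MvPolynomial σ 𝕜)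
    (T : Finset (σ →₀ ℕ)) (hT : G.support ⊆ T) :
    contract G f = ∑ β ∈ T, G.coeff β • f.divMonomial β := by
  refine Finset.sum_subset hT fun β _ hβ => ?_
  rw [MvPolynomial.notMem_support_iff.mp hβ, zero_smul]

theorem contract_add {𝕜 : Type*} [Field 𝕜] {σ : Type*} (G H f : MvPolynomial σ 𝕜) :
    contract (G + H) f = contract G f + contract H f := by
  classical
  rw [contract_eq_sum (G + H) f (G.support ∪ H.support) MvPolynomial.support_add,
    contract_eq_sum G f (G.support ∪ H.support) Finset.subset_union_left,
    contract_eq_sum H f (G.support ∪ H.support) Finset.subset_union_right,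
    ← Finset.sum_add_distrib]
  exact Finset.sum_congr rfl fun β _ => by rw [MvPolynomial.coeff_add, add_smul]

theorem contract_monomial {𝕜 : Type*} [Field 𝕜] {σ : Type*} (β : σ →₀ ℕ) (b : 𝕜)
    (f : MvPolynomial σ 𝕜) :
    contract (MvPolynomial.monomial β b) f = b • f.divMonomial β := by
  classical
  rw [contract_eq_sum _ f {β} MvPolynomial.support_monomial_subset]
  simp

theorem contract_monomial_mul {𝕜 : Type*} [Field 𝕜] {σ : Type*} (β : σ →₀ ℕ) (b : 𝕜)
    (H f : MvPolynomial σ 𝕜) :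
    contract (MvPolynomial.monomial β b * H) f = b • (contract H f).divMonomial β := by
  induction H using MvPolynomial.induction_on' with
  | monomial γ c =>
    rw [MvPolynomial.monomial_mul, contract_monomial, contract_monomial]
    ext δ
    simp only [MvPolynomial.coeff_smul, MvPolynomial.coeff_divMonomial, smul_eq_mul]
    rw [add_comm β γ, add_assoc, mul_assoc]
  | add p q hp hq =>
    rw [mul_add, contract_add, hp, hq, contract_add, MvPolynomial.add_divMonomial, smul_add]

/-- The annihilator of `f` with respect to contraction. -/
def contractAnn {𝕜 : Type*} [Field 𝕜] {σ : Type*} (f : MvPolynomial σ 𝕜) :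
    Ideal (MvPolynomial σ 𝕜) where
  carrier := {g | contract g f = 0}
  zero_mem' := by simp [contract]
  add_mem' {g h} hg hh := by
    change contract (g + h) f = 0
    rw [contract_add, show contract g f = 0 from hg, show contract h f = 0 from hh, add_zero]
  smul_mem' c {g} hg := by
    change contract (c * g) f = 0
    replace hg : contract g f = 0 := hg
    induction c using MvPolynomial.induction_on' with
    | monomial β b => rw [contract_monomial_mul, hg, MvPolynomial.zero_divMonomial, smul_zero]
    | add p q hp hq => rw [add_mul, contract_add, hp, hq, add_zero]

/-! ### Natural apolar schemes

Fix `ℓ` and an index `j` with `ℓ_j ≠ 0`. The linear form `L` and the variables `X_m`, `m ≠ j`, form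
a basis of `S_1`; the `m ≠ j` are listed in increasing order as `j.succAbove i`, `i : Fin n`. -/

/-- The linear form `L = ∑ ℓ_m X_m`. -/
def linearForm {𝕜 : Type*} [Field 𝕜] {n : ℕ} (ℓ : Fin (n + 1) → 𝕜) :
    MvPolynomial (Fin (n + 1)) 𝕜 :=
  ∑ m, MvPolynomial.C (ℓ m) * MvPolynomial.X m

/-- The change of coordinates `φ` on `S` with `φ(L) = X_0` and `φ(X_{j.succAbove i}) = X_{i+1}`. -/
def changeCoords {𝕜 : Type*} [Field 𝕜] {n : ℕ} (ℓ : Fin (n + 1) → 𝕜) (j : Fin (n + 1)) :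
    MvPolynomial (Fin (n + 1)) 𝕜 →ₐ[𝕜] MvPolynomial (Fin (n + 1)) 𝕜 :=
  MvPolynomial.aeval
    (j.insertNth (α := fun _ => MvPolynomial (Fin (n + 1)) 𝕜)
      (MvPolynomial.C (ℓ j)⁻¹ * (MvPolynomial.X 0 -
        ∑ i : Fin n, MvPolynomial.C (ℓ (j.succAbove i)) * MvPolynomial.X i.succ))
      fun i => MvPolynomial.X i.succ)

/-- The dehomogenization `f_L = F̃_dp(1, x_1, …, x_n)` of `F` by `L`, where `F̃ = φ(F)`. The divided
power monomial `X_0^[a] x^[β]` is sent to `x^[β]`. -/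
def localization {𝕜 : Type*} [Field 𝕜] {n : ℕ} (F : MvPolynomial (Fin (n + 1)) 𝕜)
    (ℓ : Fin (n + 1) → 𝕜) (j : Fin (n + 1)) : MvPolynomial (Fin n) 𝕜 :=
  MvPolynomial.aeval
    (Fin.cons 1 MvPolynomial.X : Fin (n + 1) → MvPolynomial (Fin n) 𝕜)
    (toDP (changeCoords ℓ j F))

/-- Restriction of the coordinate ring `R` to the affine chart of `ℙⁿ` centred at `[L]` with the
coordinates dual to the above basis of `S_1`: a form `G` is sent to
`G(ℓ + y_1 e_{j.succAbove 0} + … + y_n e_{j.succAbove (n-1)})`. -/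
def chart {𝕜 : Type*} [Field 𝕜] {n : ℕ} (ℓ : Fin (n + 1) → 𝕜) (j : Fin (n + 1)) :
    MvPolynomial (Fin (n + 1)) 𝕜 →ₐ[𝕜] MvPolynomial (Fin n) 𝕜 :=
  MvPolynomial.aeval fun m =>
    MvPolynomial.C (ℓ m) + j.insertNth (α := fun _ => MvPolynomial (Fin n) 𝕜) 0 MvPolynomial.X m

theorem homogeneousComponent_X_mul {𝕜 : Type*} [Field 𝕜] {n : ℕ} (j : Fin (n + 1))
    (G : MvPolynomial (Fin (n + 1)) 𝕜) (e : ℕ) :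
    MvPolynomial.homogeneousComponent (e + 1) (MvPolynomial.X j * G)
      = MvPolynomial.X j * MvPolynomial.homogeneousComponent e G := by
  classical
  ext m
  rw [MvPolynomial.coeff_homogeneousComponent, MvPolynomial.coeff_X_mul',
    MvPolynomial.coeff_X_mul', MvPolynomial.coeff_homogeneousComponent]
  by_cases hm : j ∈ m.support
  · have h1 : Finsupp.single j 1 ≤ m := by
      rw [Finsupp.single_le_iff]
      exact Nat.one_le_iff_ne_zero.2 (Finsupp.mem_support_iff.1 hm)
    have h2 : m.degree = (m - Finsupp.single j 1).degree + 1 := by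
      conv_lhs => rw [← tsub_add_cancel_of_le h1]
      simp
    simp [hm, h2]
  · simp [hm]

theorem formsIdeal_chart_saturated {𝕜 : Type*} [Field 𝕜] {n : ℕ} (ℓ : Fin (n + 1) → 𝕜)
    (j : Fin (n + 1)) (hj : ℓ j ≠ 0)
    (J : Ideal (MvPolynomial (Fin n) 𝕜)) (G : MvPolynomial (Fin (n + 1)) 𝕜)
    (hG : ∀ i, MvPolynomial.X i * G ∈ formsIdeal (J.comap (chart ℓ j))) :
    G ∈ formsIdeal (J.comap (chart ℓ j)) := by
  rw [← MvPolynomial.sum_homogeneousComponent G]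
  refine Ideal.sum_mem _ fun e _ => Ideal.subset_span
    ⟨?_, e, MvPolynomial.homogeneousComponent_isHomogeneous e G⟩
  have h1 := formsIdeal_le _ (formsIdeal_homogeneous _ _ (hG j) (e + 1))
  rw [homogeneousComponent_X_mul, Ideal.mem_comap, map_mul] at h1
  have h3 : chart ℓ j (MvPolynomial.X j) = MvPolynomial.C (ℓ j) := by simp [chart]
  rw [h3] at h1
  have h4 := J.mul_mem_left (MvPolynomial.C (ℓ j)⁻¹) h1
  rwa [← mul_assoc, ← map_mul, inv_mul_cancel₀ hj, map_one, one_mul] at h4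

/-- The natural apolar scheme `Z_{F,L}` to `F` supported at `[L]`: the closed subscheme of `ℙⁿ`
locally defined by the contraction annihilator of `f_L` in the affine chart centred at `[L]`.
Its homogeneous ideal is generated by the forms whose restriction to the chart annihilates `f_L`.
It does not depend on the index `j` with `ℓ_j ≠ 0` used to fix the coordinates. -/
def naturalApolarScheme {𝕜 : Type*} [Field 𝕜] {n : ℕ} (F : MvPolynomial (Fin (n + 1)) 𝕜)
    (ℓ : Fin (n + 1) → 𝕜) (hℓ : ℓ ≠ 0) : ProjSubscheme 𝕜 n :=
  let j := Classical.choose (Function.ne_iff.1 hℓ)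
  { ideal := formsIdeal ((contractAnn (localization F ℓ j)).comap (chart ℓ j))
    homogeneous := formsIdeal_homogeneous _
    saturated := formsIdeal_chart_saturated ℓ j (Classical.choose_spec (Function.ne_iff.1 hℓ)) _ }

/-! ### Generalized additive decompositions -/

/-- A generalized additive decomposition `F = ∑ i, L_i ^ (d - k_i) * G_i` of `F ∈ S_d`, indexed by
the finite type `ι`. -/
structure GAD {𝕜 : Type*} [Field 𝕜] {n : ℕ} (d : ℕ) (F : MvPolynomial (Fin (n + 1)) 𝕜)
    (ι : Type*) [Fintype ι] where
  /-- the coefficient vectors of the linear forms `L_i` -/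
  L : ι → Fin (n + 1) → 𝕜
  L_ne_zero : ∀ i, L i ≠ 0
  not_proportional : ∀ i j, i ≠ j → ∀ c : 𝕜, L i ≠ c • L j
  /-- the degrees of the `G_i` -/
  k : ι → ℕ
  k_le : ∀ i, k i ≤ d
  /-- the cofactors `G_i` -/
  G : ι → MvPolynomial (Fin (n + 1)) 𝕜
  G_homogeneous : ∀ i, (G i).IsHomogeneous (k i)
  not_dvd : ∀ i, ¬ linearForm (L i) ∣ G i
  sum_eq : F = ∑ i, linearForm (L i) ^ (d - k i) * G i

/-- The scheme evinced by a GAD: the union of the natural apolar schemes to the summands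
`L_i ^ (d - k_i) * G_i` supported at the `[L_i]`. -/
def GAD.scheme {𝕜 : Type*} [Field 𝕜] {n d : ℕ} {F : MvPolynomial (Fin (n + 1)) 𝕜} {ι : Type*}
    [Fintype ι] (D : GAD d F ι) : ProjSubscheme 𝕜 n :=
  ProjSubscheme.union fun i =>
    naturalApolarScheme (linearForm (D.L i) ^ (d - D.k i) * D.G i) (D.L i) (D.L_ne_zero i)

end GADScheme

end

noncomputable section

namespace GADScheme

open MvPolynomial

/-! The proof is by duality. In characteristic `0` the apolarity pairing of `S_d` with `R_d` is
perfect, and `F` defines a functional that vanishes on `I(Z)`, the intersection of the `I(Z_i)`. The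
annihilator of a finite intersection of subspaces is the sum of their annihilators, so `F = ∑ f_i`
with each `f_i ∈ S_d` orthogonal to `I(Z_i)_d` (`exists_sum_of_union_isApolar`).

The rest is local at one point `[L]`. In the chart at `[L]` the pairing of forms of degree `d`
becomes the contraction pairing (`dpPairing_localization`), and the ideal of `Z_i` contains every
monomial of degree `> k`, where `k = k̃_i ≤ d`. Cutting off degrees `> d` and using saturation, the
localization of `f_i` is orthogonal to the whole local ideal (`dpPairing_localization_eq_zero`).
Hence `Z_i` contains the natural apolar scheme of `f_i`; moreover the localization has degree at
most `k`, which means `L^(d-k) ∣ f_i`. Extracting the highest power of `L` gives the summand.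
Indices giving the same point are merged beforehand, and zero summands are dropped. -/

/-! ### The pairing between polynomials and divided powers -/

/-- The perfect pairing between `𝕜[y]` and the divided power ring for which the monomials `y^β` and
`x^[β]` are dual to each other. -/
def dpPairing (𝕜 : Type*) [Field 𝕜] (σ : Type*) :
    MvPolynomial σ 𝕜 →ₗ[𝕜] MvPolynomial σ 𝕜 →ₗ[𝕜] 𝕜 :=
  ((basisMonomials σ 𝕜).constr 𝕜).toLinearMap ∘ₗ LinearMap.pi fun β => lcoeff 𝕜 β

section Pairing

variable {𝕜 : Type*} [Field 𝕜] {σ : Type*}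

theorem dpPairing_monomial (f : MvPolynomial σ 𝕜) (β : σ →₀ ℕ) (c : 𝕜) :
    dpPairing 𝕜 σ f (monomial β c) = c * f.coeff β := by
  have h : (monomial β c : MvPolynomial σ 𝕜) = c • basisMonomials σ 𝕜 β := by
    simp [smul_monomial]
  rw [h, map_smul, smul_eq_mul, dpPairing, LinearMap.comp_apply, LinearEquiv.coe_coe,
    Module.Basis.constr_basis]
  simp

theorem dpPairing_eq_sum (f g : MvPolynomial σ 𝕜) :
    dpPairing 𝕜 σ f g = ∑ β ∈ g.support, g.coeff β * f.coeff β := by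
  conv_lhs => rw [g.as_sum, map_sum]
  simp only [dpPairing_monomial]

theorem coeff_contract (g f : MvPolynomial σ 𝕜) (γ : σ →₀ ℕ) :
    (contract g f).coeff γ = dpPairing 𝕜 σ f (monomial γ 1 * g) := by
  induction g using MvPolynomial.induction_on' with
  | monomial β c =>
    rw [contract_monomial, coeff_smul, coeff_divMonomial, monomial_mul, dpPairing_monomial,
      one_mul, add_comm, smul_eq_mul]
  | add p q hp hq => rw [contract_add, coeff_add, hp, hq, mul_add, map_add]

/-- The coefficients of `contract g f` are pairings of `f` with monomial multiples of `g`, which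
stay in the ideal; so one scalar condition on `I` controls the whole contraction. -/
theorem le_contractAnn (f : MvPolynomial σ 𝕜) (I : Ideal (MvPolynomial σ 𝕜))
    (h : ∀ g ∈ I, dpPairing 𝕜 σ f g = 0) : I ≤ contractAnn f := by
  intro g hg
  change contract g f = 0
  ext γ
  rw [coeff_contract, h _ (I.mul_mem_left _ hg), coeff_zero]

variable [Fintype σ]

theorem coeff_toDP (F : MvPolynomial σ 𝕜) (α : σ →₀ ℕ) :
    (toDP F).coeff α = F.coeff α * ∏ i, ((α i).factorial : 𝕜) := by
  classical
  simp only [toDP, coeff_sum, coeff_monomial]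
  rw [Finset.sum_ite_eq' F.support α]
  split_ifs with h
  · rfl
  · rw [notMem_support_iff.1 h, zero_mul]

theorem toDP_add (F G : MvPolynomial σ 𝕜) : toDP (F + G) = toDP F + toDP G := by
  ext α
  simp only [coeff_toDP, coeff_add, add_mul]

theorem toDP_smul (c : 𝕜) (F : MvPolynomial σ 𝕜) : toDP (c • F) = c • toDP F := by
  ext α
  simp only [coeff_toDP, coeff_smul, smul_eq_mul, mul_assoc]

theorem toDP_isHomogeneous {F : MvPolynomial σ 𝕜} {d : ℕ} (hF : F.IsHomogeneous d) :
    (toDP F).IsHomogeneous d :=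
  IsHomogeneous.sum _ _ _ fun _ hα =>
    isHomogeneous_monomial _ (hF.degree_eq_sum_deg_support hα).symm

theorem prod_factorial_ne_zero [CharZero 𝕜] (α : σ →₀ ℕ) :
    ∏ i, ((α i).factorial : 𝕜) ≠ 0 :=
  Finset.prod_ne_zero_iff.2 fun _ _ => Nat.cast_ne_zero.2 (Nat.factorial_ne_zero _)

/-- Only equal exponents contribute a constant, with factor `β!`, the same factor that `toDP`
inserts. This is how apolarity enters the argument. -/
theorem coeff_zero_diffAct (G F : MvPolynomial σ 𝕜) :
    (diffAct G F).coeff 0 = dpPairing 𝕜 σ (toDP F) G := by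
  classical
  rw [dpPairing_eq_sum, diffAct, coeff_sum]
  refine Finset.sum_congr rfl fun β _ => ?_
  rw [coeff_sum, coeff_toDP, Finset.sum_eq_single β]
  · rw [if_pos le_rfl, tsub_self, coeff_monomial, if_pos rfl, mul_assoc]
    simp only [Nat.descFactorial_self]
  · intro α _ hne
    split_ifs with h
    · rw [coeff_monomial, if_neg]
      intro h0
      exact hne (le_antisymm (tsub_eq_zero_iff_le.1 h0) h)
    · exact coeff_zero _
  · intro h
    simp [notMem_support_iff.1 h]

/-- Multiplication by `Y_m` is adjoint to `∂/∂X_m`. -/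
theorem dpPairing_toDP_X_mul (F H : MvPolynomial σ 𝕜) (m : σ) :
    dpPairing 𝕜 σ (toDP F) (X m * H) = dpPairing 𝕜 σ (toDP (pderiv m F)) H := by
  classical
  induction H using MvPolynomial.induction_on' with
  | monomial β c =>
    rw [X, monomial_mul, one_mul, dpPairing_monomial, dpPairing_monomial, coeff_toDP, coeff_toDP,
      coeff_pderiv, add_comm (Finsupp.single m 1) β]
    have h : ∏ i, (((β + Finsupp.single m 1 : σ →₀ ℕ) i).factorial : 𝕜)
        = (β m + 1) * ∏ i, ((β i).factorial : 𝕜) := by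
      rw [← Finset.mul_prod_erase _ _ (Finset.mem_univ m),
        ← Finset.mul_prod_erase _ (fun i => ((β i).factorial : 𝕜)) (Finset.mem_univ m), ← mul_assoc]
      congr 1
      · simp [Nat.factorial_succ]
      · refine Finset.prod_congr rfl fun i hi => ?_
        simp [(Finset.ne_of_mem_erase hi).symm]
    rw [h]
    ring
  | add p q hp hq => rw [mul_add, map_add, map_add, hp, hq]

end Pairing

/-! ### Dehomogenization -/

/-- The dehomogenization `X_0 ↦ 1`, `X_{i+1} ↦ x_i`. -/
def dehom (𝕜 : Type*) [Field 𝕜] (n : ℕ) :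
    MvPolynomial (Fin (n + 1)) 𝕜 →ₐ[𝕜] MvPolynomial (Fin n) 𝕜 :=
  aeval (Fin.cons 1 X : Fin (n + 1) → MvPolynomial (Fin n) 𝕜)

section Coordinates

variable {𝕜 : Type*} [Field 𝕜] {n : ℕ}

theorem degree_eq_add_degree_tail (α : Fin (n + 1) →₀ ℕ) :
    α.degree = α 0 + α.tail.degree := by
  simp [Finsupp.degree_eq_sum, Fin.sum_univ_succ, Finsupp.tail_apply]

theorem dehom_monomial (α : Fin (n + 1) →₀ ℕ) (c : 𝕜) :
    dehom 𝕜 n (monomial α c) = monomial α.tail c := by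
  rw [dehom, aeval_monomial, monomial_eq, Finsupp.prod_fintype _ _ (by simp),
    Finsupp.prod_fintype _ _ (by simp), Fin.prod_univ_succ]
  simp [algebraMap_eq, Finsupp.tail_apply]

theorem eq_of_tail_eq {α β : Fin (n + 1) →₀ ℕ} (hd : α.degree = β.degree)
    (ht : α.tail = β.tail) : α = β := by
  rw [degree_eq_add_degree_tail, degree_eq_add_degree_tail, ht] at hd
  rw [← Finsupp.cons_tail α, ← Finsupp.cons_tail β, ht, Nat.add_right_cancel hd]

/-- In a fixed degree the exponent of `X 0` is determined by the others, so no two monomials of a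
form merge under dehomogenization. -/
theorem coeff_tail_dehom {f : MvPolynomial (Fin (n + 1)) 𝕜} {d : ℕ} (hf : f.IsHomogeneous d)
    {α : Fin (n + 1) →₀ ℕ} (hα : α.degree = d) : (dehom 𝕜 n f).coeff α.tail = f.coeff α := by
  classical
  conv_lhs => rw [f.as_sum, map_sum, coeff_sum]
  rw [Finset.sum_eq_single α]
  · rw [dehom_monomial, coeff_monomial, if_pos rfl]
  · intro β hβ hne
    rw [dehom_monomial, coeff_monomial, if_neg]
    intro h
    exact hne (eq_of_tail_eq ((hf.degree_eq_sum_deg_support hβ).symm.trans hα.symm) h)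
  · intro h
    rw [notMem_support_iff.1 h, monomial_zero, map_zero, coeff_zero]

theorem coeff_dehom_eq_zero {f : MvPolynomial (Fin (n + 1)) 𝕜} {d : ℕ} (hf : f.IsHomogeneous d)
    {β : Fin n →₀ ℕ} (hβ : d < β.degree) : (dehom 𝕜 n f).coeff β = 0 := by
  classical
  rw [f.as_sum, map_sum, coeff_sum]
  refine Finset.sum_eq_zero fun α hα => ?_
  rw [dehom_monomial, coeff_monomial, if_neg]
  rintro rfl
  have h : d = α.degree := hf.degree_eq_sum_deg_support hα
  have h2 := degree_eq_add_degree_tail α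
  omega

theorem dpPairing_dehom {f g : MvPolynomial (Fin (n + 1)) 𝕜} {d : ℕ} (hf : f.IsHomogeneous d)
    (hg : g.IsHomogeneous d) :
    dpPairing 𝕜 (Fin n) (dehom 𝕜 n f) (dehom 𝕜 n g) = dpPairing 𝕜 (Fin (n + 1)) f g := by
  rw [g.as_sum, map_sum, map_sum, map_sum]
  refine Finset.sum_congr rfl fun α hα => ?_
  rw [dehom_monomial, dpPairing_monomial, dpPairing_monomial,
    coeff_tail_dehom hf (hg.degree_eq_sum_deg_support hα).symm]

theorem eq_zero_of_dehom_eq_zero {f : MvPolynomial (Fin (n + 1)) 𝕜} {d : ℕ}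
    (hf : f.IsHomogeneous d) (h : dehom 𝕜 n f = 0) : f = 0 := by
  ext α
  by_cases hα : α.degree = d
  · rw [← coeff_tail_dehom hf hα, h, coeff_zero, coeff_zero]
  · exact hf.coeff_eq_zero hα

/-! ### Linear changes of coordinates -/

variable (ℓ : Fin (n + 1) → 𝕜) (j : Fin (n + 1))

/-- The change of coordinates on `R` contragredient to `changeCoords`. -/
def dualCoords : MvPolynomial (Fin (n + 1)) 𝕜 →ₐ[𝕜] MvPolynomial (Fin (n + 1)) 𝕜 :=
  aeval fun m => C (ℓ m) * X 0 +
    j.insertNth (α := fun _ => MvPolynomial (Fin (n + 1)) 𝕜) 0 (fun i => X i.succ) m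

/-- The linear form in `R` that takes the value `1` on the chart. -/
def chartUnit : MvPolynomial (Fin (n + 1)) 𝕜 := C (ℓ j)⁻¹ * X j

/-- The linear forms in `R` whose restrictions to the chart are the coordinates. -/
def chartCoord (i : Fin n) : MvPolynomial (Fin (n + 1)) 𝕜 :=
  X (j.succAbove i) - C (ℓ (j.succAbove i)) * chartUnit ℓ j

/-- The inverse of `changeCoords`. -/
def changeCoordsInv : MvPolynomial (Fin (n + 1)) 𝕜 →ₐ[𝕜] MvPolynomial (Fin (n + 1)) 𝕜 :=
  aeval (Fin.cons (linearForm ℓ) fun i => X (j.succAbove i) :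
    Fin (n + 1) → MvPolynomial (Fin (n + 1)) 𝕜)

theorem chartUnit_isHomogeneous : (chartUnit ℓ j).IsHomogeneous 1 :=
  isHomogeneous_C_mul_X _ _

theorem chartCoord_isHomogeneous (i : Fin n) : (chartCoord ℓ j i).IsHomogeneous 1 :=
  (isHomogeneous_X _ _).sub ((chartUnit_isHomogeneous ℓ j).C_mul _)

theorem linearForm_isHomogeneous : (linearForm ℓ).IsHomogeneous 1 :=
  IsHomogeneous.sum _ _ _ fun _ _ => isHomogeneous_C_mul_X _ _

theorem dehom_dualCoords (H : MvPolynomial (Fin (n + 1)) 𝕜) :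
    dehom 𝕜 n (dualCoords ℓ j H) = chart ℓ j H := by
  have h : (dehom 𝕜 n).comp (dualCoords ℓ j) = chart ℓ j := by
    ext m : 1
    rcases Fin.eq_self_or_eq_succAbove j m with rfl | ⟨i, rfl⟩ <;>
      simp [dehom, dualCoords, chart, algebraMap_eq]
  exact DFunLike.congr_fun h H

theorem dualCoords_isHomogeneous {H : MvPolynomial (Fin (n + 1)) 𝕜} {e : ℕ}
    (hH : H.IsHomogeneous e) : (dualCoords ℓ j H).IsHomogeneous e := by
  rw [← one_mul e]
  refine hH.aeval _ fun m => (isHomogeneous_C_mul_X _ _).add ?_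
  rcases Fin.eq_self_or_eq_succAbove j m with rfl | ⟨i, rfl⟩
  · simpa using isHomogeneous_zero _ _ _
  · simpa using isHomogeneous_X _ _

theorem changeCoords_isHomogeneous {F : MvPolynomial (Fin (n + 1)) 𝕜} {e : ℕ}
    (hF : F.IsHomogeneous e) : (changeCoords ℓ j F).IsHomogeneous e := by
  rw [← one_mul e]
  refine hF.aeval _ fun m => ?_
  rcases Fin.eq_self_or_eq_succAbove j m with rfl | ⟨i, rfl⟩
  · rw [Fin.insertNth_apply_same]
    exact ((isHomogeneous_X _ _).sub
      (IsHomogeneous.sum _ _ _ fun _ _ => isHomogeneous_C_mul_X _ _)).C_mul _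
  · simpa using isHomogeneous_X _ _

theorem localization_eq_dehom (F : MvPolynomial (Fin (n + 1)) 𝕜) :
    localization F ℓ j = dehom 𝕜 n (toDP (changeCoords ℓ j F)) := rfl

variable {ℓ j}

theorem linearForm_ne_zero (hj : ℓ j ≠ 0) : linearForm ℓ ≠ 0 := by
  intro h
  apply hj
  have h2 := congrArg (eval (Pi.single j 1)) h
  simpa [linearForm, Pi.single_apply] using h2

theorem chart_chartUnit (hj : ℓ j ≠ 0) : chart ℓ j (chartUnit ℓ j) = 1 := by
  simp [chart, chartUnit, algebraMap_eq, ← C_mul, hj]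

theorem chart_chartCoord (hj : ℓ j ≠ 0) (i : Fin n) : chart ℓ j (chartCoord ℓ j i) = X i := by
  rw [chartCoord, map_sub, map_mul, chart_chartUnit hj]
  simp [chart, algebraMap_eq]

theorem X_eq_chartUnit (hj : ℓ j ≠ 0) : X j = C (ℓ j) * chartUnit ℓ j := by
  rw [chartUnit, ← mul_assoc, ← C_mul, mul_inv_cancel₀ hj, C_1, one_mul]

theorem dualCoords_injective (hj : ℓ j ≠ 0) : Function.Injective (dualCoords ℓ j) := by
  -- An explicit left inverse: `X 0` goes to `chartUnit` and `X i.succ` to `chartCoord i`.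
  have h : ((aeval (Fin.cons (chartUnit ℓ j) (chartCoord ℓ j) :
      Fin (n + 1) → MvPolynomial (Fin (n + 1)) 𝕜)).comp (dualCoords ℓ j)) = AlgHom.id 𝕜 _ := by
    ext m : 1
    rcases Fin.eq_self_or_eq_succAbove j m with rfl | ⟨i, rfl⟩
    · simp [dualCoords, algebraMap_eq, ← X_eq_chartUnit hj]
    · simp [dualCoords, algebraMap_eq, chartCoord]
  intro H H' hH
  rw [← AlgHom.id_apply (R := 𝕜) H, ← AlgHom.id_apply (R := 𝕜) H', ← h, AlgHom.comp_apply, hH,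
    AlgHom.comp_apply]

theorem eq_zero_of_chart_eq_zero (hj : ℓ j ≠ 0) {H : MvPolynomial (Fin (n + 1)) 𝕜} {e : ℕ}
    (hH : H.IsHomogeneous e) (h : chart ℓ j H = 0) : H = 0 := by
  rw [← dehom_dualCoords] at h
  refine dualCoords_injective hj ?_
  rw [eq_zero_of_dehom_eq_zero (dualCoords_isHomogeneous ℓ j hH) h, map_zero]

theorem changeCoordsInv_changeCoords (hj : ℓ j ≠ 0) (F : MvPolynomial (Fin (n + 1)) 𝕜) :
    changeCoordsInv ℓ j (changeCoords ℓ j F) = F := by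
  have h : (changeCoordsInv ℓ j).comp (changeCoords ℓ j) = AlgHom.id 𝕜 _ := by
    ext m : 1
    rcases Fin.eq_self_or_eq_succAbove j m with rfl | ⟨i, rfl⟩
    · simp [changeCoordsInv, changeCoords, algebraMap_eq, linearForm,
        Fin.sum_univ_succAbove _ m, ← mul_assoc, ← C_mul, hj]
    · simp [changeCoordsInv, changeCoords]
  exact DFunLike.congr_fun h F

/-- The chain rule: both sides are derivations along `changeCoords` in `F`, so it suffices to
compare them on variables. The right side is `dualCoords ℓ j (X m)` acting by differentiation. -/
theorem changeCoords_pderiv (hj : ℓ j ≠ 0) (F : MvPolynomial (Fin (n + 1)) 𝕜)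
    (m : Fin (n + 1)) :
    changeCoords ℓ j (pderiv m F) = ℓ m • pderiv 0 (changeCoords ℓ j F) +
      j.insertNth (α := fun _ => MvPolynomial (Fin (n + 1)) 𝕜) 0
        (fun i => pderiv i.succ (changeCoords ℓ j F)) m := by
  classical
  induction F using MvPolynomial.induction_on with
  | C c =>
    rcases Fin.eq_self_or_eq_succAbove j m with rfl | ⟨i, rfl⟩ <;>
      simp [changeCoords, algebraMap_eq]
  | add p q hp hq =>
    simp only [map_add, hp, hq]
    rcases Fin.eq_self_or_eq_succAbove j m with rfl | ⟨i, rfl⟩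
    · simp
    · simp only [Fin.insertNth_apply_succAbove, smul_add]
      ring
  | mul_X p k hp =>
    have hX : changeCoords ℓ j (pderiv m (X k)) = ℓ m • pderiv 0 (changeCoords ℓ j (X k)) +
      j.insertNth (α := fun _ => MvPolynomial (Fin (n + 1)) 𝕜) 0
        (fun i => pderiv i.succ (changeCoords ℓ j (X k))) m := by
      rcases Fin.eq_self_or_eq_succAbove j m with hm | ⟨i, hm⟩ <;>
      rcases Fin.eq_self_or_eq_succAbove j k with hk | ⟨i', hk⟩ <;> subst hm hk
      · simp [changeCoords, Pi.single_apply]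
        rw [smul_eq_C_mul, ← C_mul, mul_inv_cancel₀ hj, C_1]
      · simp [changeCoords, Pi.single_apply]
      · simp [changeCoords, Pi.single_apply]
        rw [smul_eq_C_mul]
        ring
      · simp [changeCoords, Pi.single_apply]
    simp only [pderiv_mul, map_add, map_mul, hp, hX]
    rcases Fin.eq_self_or_eq_succAbove j m with rfl | ⟨i, rfl⟩
    · simp only [Fin.insertNth_apply_same, smul_eq_C_mul]
      ring
    · simp only [Fin.insertNth_apply_succAbove, smul_eq_C_mul]
      ring

/-- Each variable of `H` is moved across the pairing as a derivative of `F`, where the chain rule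
applies; hence the induction on `H` with `F` generalized. In the base case a linear substitution
preserves constant terms. -/
theorem dpPairing_changeCoords (hj : ℓ j ≠ 0) (F H : MvPolynomial (Fin (n + 1)) 𝕜) :
    dpPairing 𝕜 _ (toDP (changeCoords ℓ j F)) (dualCoords ℓ j H) =
      dpPairing 𝕜 _ (toDP F) H := by
  induction H using MvPolynomial.induction_on generalizing F with
  | C c =>
    have h0 : (changeCoords ℓ j F).coeff 0 = F.coeff 0 := by
      rw [← constantCoeff_eq, changeCoords, ← AlgHom.coe_toRingHom, ← RingHom.comp_apply]
      congr 1
      ext m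
      · simp
      · rcases Fin.eq_self_or_eq_succAbove j m with rfl | ⟨i, rfl⟩ <;> simp
    rw [dualCoords, aeval_C, algebraMap_eq, C_apply, dpPairing_monomial, dpPairing_monomial,
      coeff_toDP, coeff_toDP, h0]
  | add p q hp hq => simp only [map_add, hp, hq]
  | mul_X p m hp =>
    rw [mul_comm p, dpPairing_toDP_X_mul, ← hp, changeCoords_pderiv hj, map_mul, toDP_add,
      toDP_smul, map_add, map_smul, LinearMap.add_apply, LinearMap.smul_apply,
      ← dpPairing_toDP_X_mul]
    have h : dualCoords ℓ j (X m) = C (ℓ m) * X 0 +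
        j.insertNth (α := fun _ => MvPolynomial (Fin (n + 1)) 𝕜) 0 (fun i => X i.succ) m := by
      simp [dualCoords]
    rw [h, add_mul, map_add, mul_assoc, C_mul', map_smul]
    congr 1
    rcases Fin.eq_self_or_eq_succAbove j m with rfl | ⟨i, rfl⟩
    · have h0 : toDP (0 : MvPolynomial (Fin (n + 1)) 𝕜) = 0 := by simp [toDP]
      simp [h0]
    · simp only [Fin.insertNth_apply_succAbove, dpPairing_toDP_X_mul]

/-- The pairing of forms of degree `d` is computed in the chart. -/
theorem dpPairing_localization (hj : ℓ j ≠ 0) {F H : MvPolynomial (Fin (n + 1)) 𝕜} {d : ℕ}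
    (hF : F.IsHomogeneous d) (hH : H.IsHomogeneous d) :
    dpPairing 𝕜 _ (localization F ℓ j) (chart ℓ j H) = dpPairing 𝕜 _ (toDP F) H := by
  rw [localization_eq_dehom, ← dehom_dualCoords,
    dpPairing_dehom (toDP_isHomogeneous (changeCoords_isHomogeneous ℓ j hF))
      (dualCoords_isHomogeneous ℓ j hH), dpPairing_changeCoords hj]

end Coordinates

section LocalIdeal

variable {𝕜 : Type*} [Field 𝕜] {n : ℕ} {ℓ : Fin (n + 1) → 𝕜} {j : Fin (n + 1)}

/-! ### The ideal of a scheme in the chart -/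

theorem chart_aeval_chartCoord (hj : ℓ j ≠ 0) (g : MvPolynomial (Fin n) 𝕜) :
    chart ℓ j (aeval (chartCoord ℓ j) g) = g := by
  have h : (chart ℓ j).comp (aeval (chartCoord ℓ j)) = AlgHom.id 𝕜 _ := by
    ext i : 1
    simp [chart_chartCoord hj]
  rw [← AlgHom.comp_apply, h, AlgHom.id_apply]

theorem chart_surjective (hj : ℓ j ≠ 0) : Function.Surjective (chart ℓ j) := fun g =>
  ⟨_, chart_aeval_chartCoord hj g⟩

theorem exists_homogenization (hj : ℓ j ≠ 0) {g : MvPolynomial (Fin n) 𝕜} {d : ℕ}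
    (hg : ∀ β ∈ g.support, β.degree ≤ d) :
    ∃ H : MvPolynomial (Fin (n + 1)) 𝕜, H.IsHomogeneous d ∧ chart ℓ j H = g := by
  refine ⟨∑ β ∈ g.support,
    chartUnit ℓ j ^ (d - β.degree) * aeval (chartCoord ℓ j) (monomial β (g.coeff β)), ?_, ?_⟩
  · refine IsHomogeneous.sum _ _ _ fun β hβ => ?_
    have h := ((chartUnit_isHomogeneous ℓ j).pow (d - β.degree)).mul
      ((isHomogeneous_monomial (g.coeff β) (rfl : β.degree = _)).aeval _
        (chartCoord_isHomogeneous ℓ j))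
    rwa [one_mul, one_mul, Nat.sub_add_cancel (hg β hβ)] at h
  · simp only [map_sum, map_mul, map_pow, chart_chartUnit hj, one_pow, one_mul,
      chart_aeval_chartCoord hj]
    exact g.as_sum.symm

/-- Modulo `℘_L` every variable is a multiple of `chartUnit`; for `m ≠ j` these elements are the
`chartCoord`. -/
theorem X_sub_mem_pointIdeal (hj : ℓ j ≠ 0) (m : Fin (n + 1)) :
    X m - C (ℓ m) * chartUnit ℓ j ∈ pointIdeal ℓ := by
  refine Ideal.subset_span ⟨?_, 1,
    (isHomogeneous_X _ _).sub ((chartUnit_isHomogeneous ℓ j).C_mul _)⟩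
  simp [RingHom.mem_ker, chartUnit, hj]

/-- `chartUnit` does not vanish at `[L]`, so it can be cancelled modulo a saturated ideal supported
there. Descending through the powers of `℘_L`, the difference between `X m` and a multiple of
`chartUnit` raises the power by one and is absorbed by `ht`; saturation then removes one factor
`chartUnit`. -/
theorem mem_of_chartUnit_pow_mul_mem (hj : ℓ j ≠ 0) (Z : ProjSubscheme 𝕜 n) {t : ℕ}
    {H : MvPolynomial (Fin (n + 1)) 𝕜} {M : ℕ} (hM : chartUnit ℓ j ^ M * H ∈ Z.ideal)
    (ht : ∀ u ∈ pointIdeal ℓ ^ t, u * H ∈ Z.ideal) : H ∈ Z.ideal := by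
  induction t with
  | zero => simpa using ht 1 (by simp)
  | succ t ih =>
    refine ih fun u hu => ?_
    have h : ∀ N, chartUnit ℓ j ^ N * (u * H) ∈ Z.ideal → u * H ∈ Z.ideal := by
      intro N
      induction N with
      | zero => simp
      | succ N ihN =>
        refine fun hN => ihN (Z.saturated _ fun m => ?_)
        have h1 : (X m - C (ℓ m) * chartUnit ℓ j) * u ∈ pointIdeal ℓ ^ (t + 1) := by
          rw [pow_succ']
          exact Ideal.mul_mem_mul (X_sub_mem_pointIdeal hj m) hu
        have h2 := Z.ideal.add_mem (Z.ideal.mul_mem_left (C (ℓ m)) hN)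
          (Z.ideal.mul_mem_left (chartUnit ℓ j ^ N) (ht _ h1))
        convert h2 using 1
        ring
    refine h M ?_
    rw [mul_left_comm]
    exact Z.ideal.mul_mem_left u hM

/-- A form belongs to the ideal of a scheme supported at `[L]` if its restriction to the chart
belongs to the ideal of the scheme in the chart. -/
theorem mem_of_chart_mem_map (hj : ℓ j ≠ 0) (Z : ProjSubscheme 𝕜 n) {t : ℕ}
    (hZ : pointIdeal ℓ ^ t ≤ Z.ideal) {H : MvPolynomial (Fin (n + 1)) 𝕜} {e : ℕ}
    (hH : H.IsHomogeneous e) (h : chart ℓ j H ∈ Z.ideal.map (chart ℓ j)) : H ∈ Z.ideal := by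
  obtain ⟨K, hK, hKH⟩ := (Ideal.mem_map_iff_of_surjective _ (chart_surjective hj)).1 h
  set N := e + K.totalDegree
  -- Padding the components of `K` to a common degree stays in the homogeneous ideal. The degree `N`
  -- also fits `chartUnit ^ K.totalDegree * H`, and the chart is injective on forms of one degree.
  set K' := ∑ i ∈ Finset.range (K.totalDegree + 1),
    chartUnit ℓ j ^ (N - i) * homogeneousComponent i K with hK'
  have hK'mem : K' ∈ Z.ideal :=
    Ideal.sum_mem _ fun i _ => Z.ideal.mul_mem_left _ (Z.homogeneous K hK i)
  have hK'hom : K'.IsHomogeneous N := by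
    refine IsHomogeneous.sum _ _ _ fun i hi => ?_
    have h := ((chartUnit_isHomogeneous ℓ j).pow (N - i)).mul
      (homogeneousComponent_isHomogeneous i K)
    rw [Finset.mem_range] at hi
    rwa [one_mul, Nat.sub_add_cancel (by omega)] at h
  have hK'chart : chart ℓ j K' = chart ℓ j K := by
    conv_rhs => rw [← K.sum_homogeneousComponent, map_sum]
    simp only [hK', map_sum, map_mul, map_pow, chart_chartUnit hj, one_pow, one_mul]
  have hHhom : (chartUnit ℓ j ^ K.totalDegree * H).IsHomogeneous N := by
    have h := ((chartUnit_isHomogeneous ℓ j).pow K.totalDegree).mul hH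
    rwa [one_mul, add_comm K.totalDegree e] at h
  have hsub : chartUnit ℓ j ^ K.totalDegree * H - K' = 0 := by
    refine eq_zero_of_chart_eq_zero hj (hHhom.sub hK'hom) ?_
    rw [map_sub, map_mul, map_pow, chart_chartUnit hj, one_pow, one_mul, hK'chart, hKH, sub_self]
  refine mem_of_chartUnit_pow_mul_mem hj Z (M := K.totalDegree) ?_
    fun u hu => Z.ideal.mul_mem_right H (hZ hu)
  rwa [sub_eq_zero.1 hsub]

/-- `y^β` lifts to a product of `β.degree` factors `chartCoord`, each in `℘_L`. -/
theorem monomial_mem_map_chart (hj : ℓ j ≠ 0) {I : Ideal (MvPolynomial (Fin (n + 1)) 𝕜)} {t : ℕ}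
    (hI : pointIdeal ℓ ^ t ≤ I) {β : Fin n →₀ ℕ} (hβ : t ≤ β.degree) (c : 𝕜) :
    monomial β c ∈ I.map (chart ℓ j) := by
  rw [← chart_aeval_chartCoord hj (monomial β c)]
  refine Ideal.mem_map_of_mem _ (hI (Ideal.pow_le_pow_right hβ ?_))
  rw [aeval_monomial, Finsupp.prod_fintype _ _ (by simp), Finsupp.degree_eq_sum,
    ← Finset.prod_pow_eq_pow_sum]
  exact Ideal.mul_mem_left _ _ (Ideal.prod_mem_prod fun i _ =>
    Ideal.pow_mem_pow (X_sub_mem_pointIdeal hj _) _)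

/-! ### Forms orthogonal to the ideal of a local scheme -/

theorem dpPairing_localization_eq_zero (hj : ℓ j ≠ 0) {Z : ProjSubscheme 𝕜 n} {d k : ℕ}
    (hk : k ≤ d) (hZ : pointIdeal ℓ ^ (k + 1) ≤ Z.ideal) {F : MvPolynomial (Fin (n + 1)) 𝕜}
    (hF : F.IsHomogeneous d)
    (hZF : ∀ H ∈ Z.ideal, H.IsHomogeneous d → dpPairing 𝕜 _ (toDP F) H = 0)
    {g : MvPolynomial (Fin n) 𝕜} (hg : g ∈ Z.ideal.map (chart ℓ j)) :
    dpPairing 𝕜 _ (localization F ℓ j) g = 0 := by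
  classical
  -- Since `k ≤ d`, the part above degree `d` lies in the local ideal, hence so does `g₁`. The first
  -- pairs to zero because the localization has degree at most `d`; the second is the restriction of
  -- a form of degree `d` in `I(Z)`.
  set g₁ := ∑ β ∈ g.support with β.degree ≤ d, monomial β (g.coeff β) with hg₁
  set g₂ := ∑ β ∈ g.support with ¬ β.degree ≤ d, monomial β (g.coeff β) with hg₂
  have hsum : g = g₁ + g₂ := by
    rw [hg₁, hg₂, Finset.sum_filter_add_sum_filter_not]
    exact g.as_sum
  have hg₂mem : g₂ ∈ Z.ideal.map (chart ℓ j) := by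
    refine Ideal.sum_mem _ fun β hβ => monomial_mem_map_chart hj hZ ?_ _
    have := (Finset.mem_filter.1 hβ).2
    omega
  have hg₁mem : g₁ ∈ Z.ideal.map (chart ℓ j) := by
    rw [eq_sub_iff_add_eq.2 hsum.symm]
    exact Ideal.sub_mem _ hg hg₂mem
  have hdeg : ∀ β ∈ g₁.support, β.degree ≤ d := by
    intro β hβ
    by_contra h
    refine mem_support_iff.1 hβ ?_
    rw [hg₁, coeff_sum]
    refine Finset.sum_eq_zero fun γ hγ => ?_
    rw [coeff_monomial, if_neg]
    rintro rfl
    exact h (Finset.mem_filter.1 hγ).2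
  obtain ⟨H, hH, hHg⟩ := exists_homogenization hj hdeg
  have h₁ : dpPairing 𝕜 _ (localization F ℓ j) g₁ = 0 := by
    rw [← hHg, dpPairing_localization hj hF hH]
    refine hZF H (mem_of_chart_mem_map hj Z hZ hH ?_) hH
    rwa [hHg]
  have h₂ : dpPairing 𝕜 _ (localization F ℓ j) g₂ = 0 := by
    rw [hg₂, map_sum]
    refine Finset.sum_eq_zero fun β hβ => ?_
    rw [dpPairing_monomial, localization_eq_dehom, coeff_dehom_eq_zero
      (toDP_isHomogeneous (changeCoords_isHomogeneous ℓ j hF))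
      (not_le.1 (Finset.mem_filter.1 hβ).2), mul_zero]
  rw [hsum, map_add, h₁, h₂, add_zero]

theorem contains_naturalApolarScheme (hℓ : ℓ ≠ 0) {Z : ProjSubscheme 𝕜 n} {d k : ℕ}
    (hk : k ≤ d) (hZ : pointIdeal ℓ ^ (k + 1) ≤ Z.ideal) {F : MvPolynomial (Fin (n + 1)) 𝕜}
    (hF : F.IsHomogeneous d)
    (hZF : ∀ H ∈ Z.ideal, H.IsHomogeneous d → dpPairing 𝕜 _ (toDP F) H = 0) :
    Z.Contains (naturalApolarScheme F ℓ hℓ) := by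
  intro G hG
  -- The same chosen index as in `naturalApolarScheme`, so the charts agree.
  have hj := Classical.choose_spec (Function.ne_iff.1 hℓ)
  rw [← G.sum_homogeneousComponent]
  refine Ideal.sum_mem _ fun e _ => Ideal.subset_span
    ⟨?_, e, homogeneousComponent_isHomogeneous e G⟩
  exact le_contractAnn _ _ (fun g => dpPairing_localization_eq_zero hj hk hZ hF hZF)
    (Ideal.mem_map_of_mem _ (Z.homogeneous G hG e))

/-! ### Divisibility by powers of the linear form. -/

theorem X_zero_pow_dvd {F : MvPolynomial (Fin (n + 1)) 𝕜} {m : ℕ}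
    (h : ∀ α ∈ F.support, m ≤ α 0) : X 0 ^ m ∣ F := by
  rw [F.as_sum]
  refine Finset.dvd_sum fun α hα => ?_
  rw [X_pow_eq_monomial, monomial_dvd_monomial]
  exact ⟨Or.inr (Finsupp.single_le_iff.2 (h α hα)), one_dvd _⟩

theorem linearForm_pow_dvd [CharZero 𝕜] (hj : ℓ j ≠ 0) {Z : ProjSubscheme 𝕜 n} {d k : ℕ}
    (hk : k ≤ d) (hZ : pointIdeal ℓ ^ (k + 1) ≤ Z.ideal) {F : MvPolynomial (Fin (n + 1)) 𝕜}
    (hF : F.IsHomogeneous d)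
    (hZF : ∀ H ∈ Z.ideal, H.IsHomogeneous d → dpPairing 𝕜 _ (toDP F) H = 0) :
    linearForm ℓ ^ (d - k) ∣ F := by
  have hφ := changeCoords_isHomogeneous ℓ j hF
  have hdvd : X 0 ^ (d - k) ∣ changeCoords ℓ j F := by
    refine X_zero_pow_dvd fun α hα => ?_
    -- A monomial with too small a power of `X 0` has a tail of degree at least `k + 1`, which lies
    -- in the local ideal; pairing with it reads off the coefficient times `α!`, which is nonzero in
    -- characteristic `0`.
    by_contra hlt
    have hαd : α.degree = d := (hφ.degree_eq_sum_deg_support hα).symm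
    have hα' := degree_eq_add_degree_tail α
    have h := dpPairing_localization_eq_zero hj hk hZ hF hZF
      (monomial_mem_map_chart hj hZ (show k + 1 ≤ α.tail.degree by omega) 1)
    rw [dpPairing_monomial, one_mul, localization_eq_dehom,
      coeff_tail_dehom (toDP_isHomogeneous hφ) hαd, coeff_toDP] at h
    exact mem_support_iff.1 hα ((mul_eq_zero.1 h).resolve_right (prod_factorial_ne_zero α))
  have h := map_dvd (changeCoordsInv ℓ j) hdvd
  rw [map_pow, changeCoordsInv_changeCoords hj] at h
  simpa [changeCoordsInv] using h

theorem homogeneousComponent_mul_of_isHomogeneous {σ : Type*} {P : MvPolynomial σ 𝕜} {m : ℕ}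
    (hP : P.IsHomogeneous m) (G : MvPolynomial σ 𝕜) (k : ℕ) :
    homogeneousComponent (m + k) (P * G) = P * homogeneousComponent k G := by
  have h : ∀ i, homogeneousComponent (m + k) (P * homogeneousComponent i G) =
      P * homogeneousComponent k (homogeneousComponent i G) := by
    intro i
    have hi := homogeneousComponent_isHomogeneous i G
    rw [homogeneousComponent_of_mem (hP.mul hi), homogeneousComponent_of_mem hi]
    simp only [Nat.add_left_cancel_iff, mul_ite, mul_zero]
  conv_lhs => rw [← G.sum_homogeneousComponent, Finset.mul_sum, map_sum]
  conv_rhs => rw [← G.sum_homogeneousComponent, map_sum, Finset.mul_sum]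
  exact Finset.sum_congr rfl fun i _ => h i

/-- Factor out the highest power of a linear form from a form. -/
theorem exists_eq_linearForm_pow_mul (hj : ℓ j ≠ 0) {F : MvPolynomial (Fin (n + 1)) 𝕜} {d t : ℕ}
    (hF : F.IsHomogeneous d) (hF0 : F ≠ 0) (ht : t ≤ d) (hdvd : linearForm ℓ ^ (d - t) ∣ F) :
    ∃ k ≤ t, ∃ G : MvPolynomial (Fin (n + 1)) 𝕜, G.IsHomogeneous k ∧ ¬ linearForm ℓ ∣ G ∧
      F = linearForm ℓ ^ (d - k) * G := by
  classical
  have hex : ∃ k, linearForm ℓ ^ (d - k) ∣ F := ⟨t, hdvd⟩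
  set k := Nat.find hex with hk
  have hkt : k ≤ t := Nat.find_min' hex hdvd
  obtain ⟨G, hG⟩ : linearForm ℓ ^ (d - k) ∣ F := Nat.find_spec hex
  have hL0 := linearForm_ne_zero hj
  have hG0 : G ≠ 0 := by
    rintro rfl
    exact hF0 (by rw [hG, mul_zero])
  have hLhom : (linearForm ℓ ^ (d - k)).IsHomogeneous (d - k) := by
    have h := (linearForm_isHomogeneous ℓ).pow (d - k)
    rwa [one_mul] at h
  have hGdeg : G.totalDegree = k := by
    have h := congrArg totalDegree hG
    rw [totalDegree_mul_of_isDomain (pow_ne_zero _ hL0) hG0, hF.totalDegree hF0,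
      hLhom.totalDegree (pow_ne_zero _ hL0)] at h
    omega
  refine ⟨k, hkt, G, ?_, ?_, hG⟩
  -- Comparing components of degree `d` and cancelling the power of `L` shows that `G` equals its
  -- own component of degree `k`.
  · have h : F = linearForm ℓ ^ (d - k) * homogeneousComponent k G := by
      rw [← homogeneousComponent_eq_self hF]
      conv_lhs => rw [hG, ← show d - k + k = d by omega]
      rw [show d - k + k - k = d - k by omega, homogeneousComponent_mul_of_isHomogeneous hLhom]
    rw [mul_left_cancel₀ (pow_ne_zero _ hL0) (hG.symm.trans h)]
    exact homogeneousComponent_isHomogeneous k G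
  · rintro ⟨G', rfl⟩
    -- For `k = 0` the cofactor is constant, so `L` cannot divide it; otherwise `k - 1` would
    -- contradict minimality.
    have hk0 : k ≠ 0 := by
      intro h0
      have h1 := totalDegree_mul_of_isDomain hL0 (right_ne_zero_of_mul hG0)
      rw [(linearForm_isHomogeneous ℓ).totalDegree hL0] at h1
      omega
    refine Nat.find_min hex (m := k - 1) (by omega) ⟨G', ?_⟩
    rw [hG, show d - (k - 1) = d - k + 1 by omega, pow_succ, mul_assoc]

/-! ### Splitting a form along a union of schemes -/

/-- Only the finitely many values of `φ` on monomials of degree `d` matter; dividing them by `α!`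
compensates for `toDP`. -/
theorem exists_form_of_dual [CharZero 𝕜] (φ : Module.Dual 𝕜 (MvPolynomial (Fin n) 𝕜)) (d : ℕ) :
    ∃ F : MvPolynomial (Fin n) 𝕜, F.IsHomogeneous d ∧
      ∀ H : MvPolynomial (Fin n) 𝕜, H.IsHomogeneous d → dpPairing 𝕜 _ (toDP F) H = φ H := by
  classical
  set T := Finset.finsuppAntidiag (Finset.univ : Finset (Fin n)) d
  have hT : ∀ α, α ∈ T ↔ α.degree = d := by
    intro α
    simp [T, Finset.mem_finsuppAntidiag, Finsupp.degree_eq_sum]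
  refine ⟨∑ α ∈ T, monomial α (φ (monomial α 1) / ∏ i, ((α i).factorial : 𝕜)),
    IsHomogeneous.sum _ _ _ fun α hα => isHomogeneous_monomial _ ((hT α).1 hα), fun H hH => ?_⟩
  rw [H.as_sum, map_sum, map_sum]
  refine Finset.sum_congr rfl fun α hα => ?_
  have hαT : α ∈ T := (hT α).2 (hH.degree_eq_sum_deg_support hα).symm
  rw [dpPairing_monomial, coeff_toDP, coeff_sum, Finset.sum_eq_single α
    (fun β _ hne => by rw [coeff_monomial, if_neg hne]) (fun h => absurd hαT h),
    coeff_monomial, if_pos rfl, div_mul_cancel₀ _ (prod_factorial_ne_zero α), ← smul_eq_mul,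
    ← map_smul, smul_monomial, smul_eq_mul, mul_one]

theorem eq_of_dpPairing_toDP_eq [CharZero 𝕜] {F F' : MvPolynomial (Fin n) 𝕜} {d : ℕ}
    (hF : F.IsHomogeneous d) (hF' : F'.IsHomogeneous d)
    (h : ∀ H : MvPolynomial (Fin n) 𝕜, H.IsHomogeneous d →
      dpPairing 𝕜 _ (toDP F) H = dpPairing 𝕜 _ (toDP F') H) : F = F' := by
  ext α
  by_cases hα : α.degree = d
  · have h1 := h (monomial α 1) (isHomogeneous_monomial _ hα)
    rw [dpPairing_monomial, dpPairing_monomial, one_mul, one_mul, coeff_toDP, coeff_toDP] at h1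
    exact mul_right_cancel₀ (prod_factorial_ne_zero α) h1
  · rw [hF.coeff_eq_zero hα, hF'.coeff_eq_zero hα]

theorem exists_sum_of_union_isApolar [CharZero 𝕜] {ι : Type*} [Fintype ι]
    (W : ι → ProjSubscheme 𝕜 n) {F : MvPolynomial (Fin (n + 1)) 𝕜} {d : ℕ}
    (hF : F.IsHomogeneous d) (hW : (ProjSubscheme.union W).IsApolar F) :
    ∃ f : ι → MvPolynomial (Fin (n + 1)) 𝕜, (∀ i, (f i).IsHomogeneous d) ∧ F = ∑ i, f i ∧
      ∀ i, ∀ H ∈ (W i).ideal, H.IsHomogeneous d → dpPairing 𝕜 _ (toDP (f i)) H = 0 := by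
  classical
  have hmem : dpPairing 𝕜 _ (toDP F) ∈
      (⨅ i, (W i).ideal.restrictScalars 𝕜).dualAnnihilator := by
    rw [Submodule.mem_dualAnnihilator]
    intro G hG
    have hG' : G ∈ (ProjSubscheme.union W).ideal := by
      change G ∈ ⨅ i, (W i).ideal
      simpa [Submodule.mem_iInf, Ideal.mem_iInf] using hG
    rw [← coeff_zero_diffAct, hW G hG', coeff_zero]
  -- The splitting takes place in the full dual of `R`; each piece is replaced by a form of degree
  -- `d` only afterwards.
  rw [Subspace.dualAnnihilator_iInf_eq, Submodule.mem_iSup_iff_exists_finsupp] at hmem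
  obtain ⟨φ, hφ, hsum⟩ := hmem
  choose f hf hfφ using fun i => exists_form_of_dual (φ i) d
  refine ⟨f, hf, ?_, fun i H hH hHd => ?_⟩
  · refine eq_of_dpPairing_toDP_eq hF (IsHomogeneous.sum _ _ _ fun i _ => hf i) fun H hH => ?_
    have htoDP : toDP (∑ i, f i) = ∑ i, toDP (f i) := by
      ext α
      simp only [coeff_toDP, coeff_sum, Finset.sum_mul]
    rw [htoDP, map_sum, LinearMap.sum_apply, Finset.sum_congr rfl fun i _ => hfφ i H hH, ← hsum,
      Finsupp.sum_fintype _ _ (fun _ => rfl), LinearMap.sum_apply]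
  · rw [hfφ i H hHd]
    exact (Submodule.mem_dualAnnihilator _).1 (hφ i) H hH

/-- Rescaling the point multiplies the value of a form of degree `e` by `c ^ e ≠ 0`. -/
theorem pointIdeal_smul {c : 𝕜} (hc : c ≠ 0) (ℓ : Fin (n + 1) → 𝕜) :
    pointIdeal (c • ℓ) = pointIdeal ℓ := by
  unfold pointIdeal formsIdeal
  congr 1
  ext G
  refine and_comm.trans ((and_congr_right ?_).trans and_comm)
  rintro ⟨e, he⟩
  have h : eval (c • ℓ) G = c ^ e * eval ℓ G := by
    rw [eval_eq', eval_eq', Finset.mul_sum]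
    refine Finset.sum_congr rfl fun α hα => ?_
    have hα' : e = ∑ i, α i :=
      (he.degree_eq_sum_deg_support hα).trans (Finsupp.degree_eq_sum α)
    simp only [Pi.smul_apply, smul_eq_mul, mul_pow, Finset.prod_mul_distrib,
      Finset.prod_pow_eq_pow_sum, ← hα']
    ring
  simp [RingHom.mem_ker, h, hc]

end LocalIdeal

end GADScheme

end

/-! ### Merging repeated points and assembling the decomposition. -/

theorem mainTheorem6 {𝕜 : Type*} [Field 𝕜] [IsAlgClosed 𝕜] [CharZero 𝕜] (n d s : ℕ)
    (F : MvPolynomial (Fin (n + 1)) 𝕜) (hF : F.IsHomogeneous d)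
    (L : Fin s → Fin (n + 1) → 𝕜) (hL : ∀ i, L i ≠ 0)
    (kt : Fin s → ℕ) (hkt : ∀ i, kt i ≤ d)
    (Z : GADScheme.ProjSubscheme 𝕜 n) (hZdim : Z.IsZeroDim) (hZF : Z.IsApolar F)
    (W : Fin s → GADScheme.ProjSubscheme 𝕜 n) (hZW : Z = GADScheme.ProjSubscheme.union W)
    (hW : ∀ i, GADScheme.pointIdeal (L i) ^ (kt i + 1) ≤ (W i).ideal) :
    ∃ (J : Finset (Fin s)) (D : GADScheme.GAD d F J),
      (∀ i : J, D.L i = L i) ∧ (∀ i : J, D.k i ≤ kt i) ∧ Z.Contains D.scheme := by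
  classical
  -- Each point of the support is represented by one of its linear forms with the largest bound.
  have hex : ∀ P, (∃ i, GADScheme.pointIdeal (L i) = P) → ∃ i, GADScheme.pointIdeal (L i) = P ∧
      ∀ i', GADScheme.pointIdeal (L i') = P → kt i' ≤ kt i := by
    rintro P ⟨i, hi⟩
    obtain ⟨i₀, hi₀, hmax⟩ := Finset.exists_max_image
      (Finset.univ.filter fun i => GADScheme.pointIdeal (L i) = P) kt ⟨i, by simpa using hi⟩
    exact ⟨i₀, by simpa using hi₀, fun i' hi' => hmax i' (by simpa using hi')⟩
  choose g hgP hgmax using hex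
  set r : Fin s → Fin s := fun i => g _ ⟨i, rfl⟩ with hr
  have hrP : ∀ i, GADScheme.pointIdeal (L (r i)) = GADScheme.pointIdeal (L i) :=
    fun i => hgP _ _
  have hrkt : ∀ i, kt i ≤ kt (r i) := fun i => hgmax _ _ i rfl
  have hr_eq : ∀ i i', GADScheme.pointIdeal (L i) = GADScheme.pointIdeal (L i') → r i = r i' := by
    intro i i' h
    simp only [hr, h]
  -- All schemes at one point are collected at its representative; every other index receives the
  -- empty scheme.
  set W' : Fin s → GADScheme.ProjSubscheme 𝕜 n :=
    fun c => GADScheme.ProjSubscheme.union fun i : {i // r i = c} => W i with hW'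
  have hZW' : Z = GADScheme.ProjSubscheme.union W' := by
    rw [hZW]
    ext G
    change G ∈ ⨅ i, (W i).ideal ↔ G ∈ ⨅ c, ⨅ i : {i // r i = c}, (W i).ideal
    simp only [Ideal.mem_iInf]
    exact ⟨fun h c i => h i, fun h i => h (r i) ⟨i, rfl⟩⟩
  have hW'p : ∀ c, GADScheme.pointIdeal (L c) ^ (kt c + 1) ≤ (W' c).ideal := by
    intro c
    refine le_iInf fun i => ?_
    obtain ⟨i, rfl⟩ := i
    rw [hrP]
    exact (Ideal.pow_le_pow_right (Nat.succ_le_succ (hrkt i))).trans (hW i)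
  obtain ⟨f, hf, hsum, horth⟩ := GADScheme.exists_sum_of_union_isApolar W' hF (hZW' ▸ hZF)
  -- At a non-representative the ideal of `W' c` is the unit ideal, so `f c` is orthogonal to all
  -- forms of degree `d` and vanishes.
  have hrep : ∀ c, f c ≠ 0 → r c = c := by
    intro c hc
    by_contra hne
    have hempty : IsEmpty {i // r i = c} := by
      refine ⟨fun ⟨i, hi⟩ => hne ?_⟩
      rw [← hi]
      exact hr_eq _ _ (hrP i)
    refine hc (GADScheme.eq_of_dpPairing_toDP_eq (hf c)
      (MvPolynomial.isHomogeneous_zero _ _ d) fun H hH => ?_)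
    have hH' : H ∈ (W' c).ideal := by
      change H ∈ ⨅ i : {i // r i = c}, (W i).ideal
      rw [iInf_of_empty]
      exact Submodule.mem_top
    rw [horth c H hH' hH]
    simp [GADScheme.toDP]
  have hfactor : ∀ c, f c ≠ 0 → ∃ k ≤ kt c, ∃ G : MvPolynomial (Fin (n + 1)) 𝕜,
      G.IsHomogeneous k ∧ ¬ GADScheme.linearForm (L c) ∣ G ∧
        f c = GADScheme.linearForm (L c) ^ (d - k) * G := by
    intro c hc
    obtain ⟨j, hj⟩ := Function.ne_iff.1 (hL c)
    exact GADScheme.exists_eq_linearForm_pow_mul hj (hf c) hc (hkt c)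
      (GADScheme.linearForm_pow_dvd hj (hkt c) (hW'p c) (hf c) (horth c))
  choose k hk G hG hndvd hfG using hfactor
  have hmem : ∀ i : (Finset.univ.filter fun c => f c ≠ 0 : Finset (Fin s)), f i ≠ 0 :=
    fun i => (Finset.mem_filter.1 i.2).2
  refine ⟨Finset.univ.filter fun c => f c ≠ 0,
    { L := fun i => L i
      L_ne_zero := fun i => hL i
      not_proportional := ?_
      k := fun i => k i (hmem i)
      k_le := fun i => (hk i (hmem i)).trans (hkt i)
      G := fun i => G i (hmem i)
      G_homogeneous := fun i => hG i (hmem i)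
      not_dvd := fun i => hndvd i (hmem i)
      sum_eq := ?_ }, fun _ => rfl, fun i => hk i (hmem i), ?_⟩
  -- Proportional forms have the same point ideal, hence the same representative, and indices with
  -- `f ≠ 0` represent themselves.
  · intro i i' hne c hc
    have hc0 : c ≠ 0 := by
      rintro rfl
      exact hL i (by rw [hc, zero_smul])
    refine hne (Subtype.ext ?_)
    rw [← hrep i (hmem i), ← hrep i' (hmem i')]
    exact hr_eq _ _ (by rw [hc, GADScheme.pointIdeal_smul hc0])
  · rw [Finset.sum_congr rfl fun (i : (Finset.univ.filter fun c => f c ≠ 0 : Finset (Fin s))) _ =>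
        (hfG i (hmem i)).symm,
      Finset.sum_coe_sort (Finset.univ.filter fun c => f c ≠ 0) f, Finset.sum_filter_ne_zero]
    exact hsum
  · rw [hZW']
    refine le_iInf fun i => (iInf_le _ i.1).trans ?_
    have h := GADScheme.contains_naturalApolarScheme (hL i) (hkt i) (hW'p i) (hf i) (horth i)
    simp only [← hfG i (hmem i)]
    exact h
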